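/- A comparator with imprecision $\delta>0$ on elements $x_1,\dots,x_n$ with fixed unknown real values $\mathrm{val}(x_i)$ answers a comparison of $x_i$ and $x_j$ by declaring which of the two is larger. The answer is correct whenever $|\mathrm{val}(x_i)-\mathrm{val}(x_j)|>\delta$ and arbitrary otherwise. The comparator may be adaptive: each answer may depend on the whole execution so far (earlier comparisons, answers and random choices of the algorithm, but not its future random choices), and repeating a comparison need not give the same answer. An element $x_i$ is a $3$-max if $\mathrm{val}(x_i)\ge \mathrm{val}(x_j)-3\delta$ for all $j$. A randomized algorithm may access the values only through comparisons, and it does not know $\delta$. For every integer $c\ge 1$, put $s=15(c+2)+1$ and $C=4^4/(5e)^5$, where $e$ is Euler's number. There exists a randomized algorithm which, given any $n\ge 1$ elements and for every $\delta>0$ and every such adaptive comparator, outputs a $3$-max with probability at least $1-n^{-c}$, and always uses at most $$(s-1)\,n+\frac12\left(\frac{c+1}{C\ln 2}\right)^{2} n^{2/3}\ln^4 n \;=\; O(n)$$ comparisons, where the implied constant depends only on $c$. -/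

import Mathlib

namespace ImpreciseMax

/-- A randomized comparison algorithm on `n` elements: a finite decision tree. A node either
stops and outputs an element, or compares two elements and continues according to the answer
(`true` means that the first element defeats the second one), or draws a fresh uniformly random
element of `Fin (k + 1)` and continues according to it. The values of the elements are accessible
only through the answers to comparisons. -/
inductive RandAlg (n : ℕ) : Type
  | output (i : Fin n) : RandAlg n
  | compare (i j : Fin n) (next : Bool → RandAlg n) : RandAlg n
  | draw (k : ℕ) (next : Fin (k + 1) → RandAlg n) : RandAlg n

/-- One step of an execution: a comparison together with its answer, or the result `r` of a
uniform draw from `{0, …, k}`. -/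
inductive Event (n : ℕ) : Type
  | answered (i j : Fin n) (b : Bool) : Event n
  | drawn (k r : ℕ) : Event n

/-- An adaptive comparator: its answer to a comparison of `i` with `j` may depend on the whole
execution so far (latest step first), i.e. on all earlier comparisons, answers and random draws.
Repeating a comparison need not repeat the answer. -/
abbrev Comparator (n : ℕ) : Type := List (Event n) → Fin n → Fin n → Bool

/-- The comparator answers correctly whenever the two values differ by more than `δ`; all other
answers are unrestricted. -/
def Comparator.IsValid {n : ℕ} (cmp : Comparator n) (δ : ℝ) (val : Fin n → ℝ) : Prop :=
  ∀ (h : List (Event n)) (i j : Fin n), δ < |val i - val j| →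
    (cmp h i j = true ↔ val j < val i)

/-- The joint law of the output and the number of comparisons made when the algorithm is run
against the comparator `cmp`, starting after the history `h`. -/
noncomputable def RandAlg.run {n : ℕ} (cmp : Comparator n) :
    RandAlg n → List (Event n) → PMF (Fin n × ℕ)
  | .output i, _ => PMF.pure (i, 0)
  | .compare i j next, h =>
      (RandAlg.run cmp (next (cmp h i j)) (.answered i j (cmp h i j) :: h)).map
        (fun p => (p.1, p.2 + 1))
  | .draw k next, h =>
      (PMF.uniformOfFintype (Fin (k + 1))).bind
        (fun r => RandAlg.run cmp (next r) (.drawn k r :: h))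

/-- `i` is a `k`-max at imprecision `δ`: no value exceeds that of `i` by more than `k * δ`. -/
def IsKMax {n : ℕ} (k : ℕ) (δ : ℝ) (val : Fin n → ℝ) (i : Fin n) : Prop :=
  ∀ j : Fin n, val j - k * δ ≤ val i

/-- The size `s = 15 (c + 2) + 1` of the groups in the tournament. -/
def groupSize (c : ℕ) : ℕ := 15 * (c + 2) + 1

/-- The constant `C = 4 ^ 4 / (5 e) ^ 5`. -/
noncomputable def sampleConst : ℝ := 4 ^ 4 / (5 * Real.exp 1) ^ 5

/-- The bound `(s - 1) n + ((c + 1) / (C ln 2)) ^ 2 / 2 * n ^ (2 / 3) * (ln n) ^ 4`. -/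
noncomputable def comparisonBound (c n : ℕ) : ℝ :=
  ((groupSize c : ℝ) - 1) * n +
    (((c : ℝ) + 1) / (sampleConst * Real.log 2)) ^ 2 / 2 *
      (n : ℝ) ^ (2 / 3 : ℝ) * Real.log n ^ 4

end ImpreciseMax

/-! Let `x` have maximal value. Only elements within `δ` of `x` may defeat it; let `B` be the set of
those still in play among `m` elements, and put `r = ⌈n^(1/3)⌉`. Each round draws a sample and then
plays random group tournaments, and one of the two protects `x`.

If `B` is dense, `|B| > m / (14 r)`, the sample misses `B` with probability at most `n^-(c+1)`. If
`B` is sparse, `x` has `k = 3 (c + 2)` defeats only if `k` other members of `B` fall into its group,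
and a union bound over `k`-subsets gives at most `n^-(c+1)` again (`card_crowded_shifts_mul_le`,
`choose_mul_le_pow`). So after at most `log₂ n` rounds, except with probability `n^-c`, the final
pool contains an element within `δ` of `x`. A tournament has a player that defeats everyone in at
most two steps, which loses `2 δ` more: a `3`-max (`failLe_roundRobin`).

Adaptivity does no harm: sample and groups are drawn before the answers of the round, and the bad
draws are described by values alone, so every allowed record of answers can be admitted.

For the cost, fewer than `k` defeats leave at most `2 k` of up to `5 k` players per group. The set
in play more than halves, and the round costs are paid by the decrease of `s |X|` with `s = 5 k`.
The final round robin on `O(n^(1/3) ln² n)` elements gives the second term. -/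

namespace ImpreciseMax

open scoped ENNReal

variable {n : ℕ}

/-! ### Cost and failure bounds for decision trees against an adaptive adversary -/

/-- Every execution of `A`, after any history, makes at most `N` comparisons. -/
def RandAlg.CostLe (A : RandAlg n) (N : ℕ) : Prop :=
  ∀ (cmp : Comparator n) (h : List (Event n)), ∀ p ∈ (A.run cmp h).support, p.2 ≤ N

/-- Against every valid comparator and after any history, `A` outputs an element outside `S` with
probability at most `ε`. -/
def RandAlg.FailLe (δ : ℝ) (val : Fin n → ℝ) (S : Set (Fin n)) (A : RandAlg n) (ε : ℝ≥0∞) : Prop :=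
  ∀ cmp : Comparator n, cmp.IsValid δ val → ∀ h : List (Event n),
    (A.run cmp h).toOuterMeasure {p | p.1 ∉ S} ≤ ε

/-- The answer `b` to the comparison of the elements of the pair `p` is allowed. -/
def Allowed (δ : ℝ) (val : Fin n → ℝ) (p : Fin n × Fin n) (b : Bool) : Prop :=
  (b = true → val p.2 ≤ val p.1 + δ) ∧ (b = false → val p.1 ≤ val p.2 + δ)

theorem Comparator.IsValid.allowed {δ : ℝ} {val : Fin n → ℝ} {cmp : Comparator n}
    (hδ : 0 ≤ δ) (hv : cmp.IsValid δ val) (h : List (Event n)) (i j : Fin n) :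
    Allowed δ val (i, j) (cmp h i j) := by
  have := hv h i j
  constructor <;> intro hb <;> by_contra hlt <;> push Not at hlt <;> simp only at hlt
  · have h1 : δ < |val i - val j| := by rw [abs_sub_comm, lt_abs]; left; linarith
    have := (this h1).1 hb
    linarith
  · have h1 : δ < |val i - val j| := by rw [lt_abs]; left; linarith
    have := (this h1).2 (by linarith)
    simp [hb] at this

namespace RandAlg

theorem CostLe.mono {A : RandAlg n} {N M : ℕ} (h : A.CostLe N) (hNM : N ≤ M) : A.CostLe M :=
  fun cmp l p hp => (h cmp l p hp).trans hNM

theorem costLe_output (i : Fin n) (N : ℕ) : (output i).CostLe N := by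
  intro cmp h p hp
  simp only [run, PMF.support_pure, Set.mem_singleton_iff] at hp
  simp [hp]

theorem costLe_compare {i j : Fin n} {next : Bool → RandAlg n} {N : ℕ}
    (h : ∀ b, (next b).CostLe N) : (compare i j next).CostLe (N + 1) := by
  intro cmp l p hp
  rw [run, PMF.support_map] at hp
  obtain ⟨p, hp, rfl⟩ := hp
  exact Nat.succ_le_succ (h _ cmp _ p hp)

theorem costLe_draw {k : ℕ} {next : Fin (k + 1) → RandAlg n} {N : ℕ}
    (h : ∀ r, (next r).CostLe N) : (draw k next).CostLe N := by
  intro cmp l p hp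
  rw [run, PMF.mem_support_bind_iff] at hp
  obtain ⟨r, -, hp⟩ := hp
  exact h r cmp _ p hp

variable {δ : ℝ} {val : Fin n → ℝ} {S : Set (Fin n)}

theorem FailLe.mono {A : RandAlg n} {ε η : ℝ≥0∞} (h : A.FailLe δ val S ε) (hle : ε ≤ η) :
    A.FailLe δ val S η :=
  fun cmp hv l => (h cmp hv l).trans hle

theorem failLe_one (A : RandAlg n) : A.FailLe δ val S 1 := by
  intro cmp hv l
  let _ : MeasurableSpace (Fin n × ℕ) := ⊤
  rw [← PMF.toMeasure_apply_eq_toOuterMeasure]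
  exact MeasureTheory.prob_le_one

theorem failLe_output {i : Fin n} (hi : i ∈ S) : (output i).FailLe δ val S 0 := by
  intro cmp hv l
  rw [run, PMF.toOuterMeasure_pure_apply, if_neg (by simpa using hi)]

/-- Since `FailLe` quantifies over all histories, the adversary reduces to a choice between the
allowed continuations. -/
theorem failLe_compare (hδ : 0 ≤ δ) {i j : Fin n} {next : Bool → RandAlg n} {ε : ℝ≥0∞}
    (h : ∀ b, Allowed δ val (i, j) b → (next b).FailLe δ val S ε) :
    (compare i j next).FailLe δ val S ε := by
  intro cmp hv l
  rw [run, PMF.toOuterMeasure_map_apply]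
  exact h _ (hv.allowed hδ l i j) cmp hv _

/-- Draw a uniformly random element of a finite type. -/
noncomputable def drawFrom (α : Type) [Fintype α] [Nonempty α] (next : α → RandAlg n) :
    RandAlg n :=
  draw (Fintype.card α - 1) fun r =>
    next ((Fintype.equivFin α).symm (finCongr (Nat.sub_add_cancel Fintype.card_pos) r))

theorem costLe_drawFrom {α : Type} [Fintype α] [Nonempty α] {next : α → RandAlg n} {N : ℕ}
    (h : ∀ a, (next a).CostLe N) : (drawFrom α next).CostLe N :=
  costLe_draw fun _ => h _

/-- Union bound. The set `bad` is fixed independently of the comparator, whose later answers cannot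
change a draw already made. -/
theorem failLe_drawFrom {α : Type} [Fintype α] [Nonempty α] {next : α → RandAlg n}
    {ε η : ℝ≥0∞} (bad : Finset α) (hbad : (bad.card : ℝ≥0∞) ≤ η * Fintype.card α)
    (h : ∀ a, a ∉ bad → (next a).FailLe δ val S ε) :
    (drawFrom α next).FailLe δ val S (η + ε) := by
  classical
  intro cmp hv l
  set e : Fin (Fintype.card α - 1 + 1) ≃ α :=
    (finCongr (Nat.sub_add_cancel Fintype.card_pos)).trans (Fintype.equivFin α).symm with he
  set K : ℝ≥0∞ := (Fintype.card α : ℝ≥0∞) with hK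
  have hK0 : K ≠ 0 := by simp [hK]
  have hKt : K ≠ ∞ := by simp [hK]
  have hcard : ((Fintype.card α - 1 : ℕ) : ℝ≥0∞) + 1 = K := by
    rw [hK]; exact_mod_cast Nat.sub_add_cancel Fintype.card_pos
  rw [drawFrom, run, PMF.toOuterMeasure_bind_apply, tsum_fintype]
  simp only [PMF.uniformOfFintype_apply, Fintype.card_fin, Nat.cast_add, Nat.cast_one, hcard]
  rw [← Finset.mul_sum]
  have key : ∀ r : Fin (Fintype.card α - 1 + 1),
      ((next (e r)).run cmp (.drawn (Fintype.card α - 1) r :: l)).toOuterMeasure {p | p.1 ∉ S} ≤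
        (if e r ∈ bad then 1 else 0) + ε := by
    intro r
    split_ifs with hr
    · exact (failLe_one _ cmp hv _).trans le_self_add
    · rw [zero_add]; exact h _ hr cmp hv _
  have hsum : ∑ r : Fin (Fintype.card α - 1 + 1), ((if e r ∈ bad then (1 : ℝ≥0∞) else 0) + ε) =
      bad.card + K * ε := by
    rw [Equiv.sum_comp e fun a => (if a ∈ bad then (1 : ℝ≥0∞) else 0) + ε,
      Finset.sum_add_distrib]
    simp [hK]
  calc _ ≤ K⁻¹ * (bad.card + K * ε) := by
        rw [← hsum]; gcongr with r; exact key r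
    _ ≤ K⁻¹ * (η * K + K * ε) := by gcongr
    _ = K⁻¹ * K * (η + ε) := by ring
    _ = η + ε := by rw [ENNReal.inv_mul_cancel hK0 hKt, one_mul]

/-- Make the comparisons in a list, recording the answers on top of the record `R`, and continue
according to the final record. -/
def compareList : List (Fin n × Fin n) → (Fin n × Fin n → Bool) →
    ((Fin n × Fin n → Bool) → RandAlg n) → RandAlg n
  | [], R, next => next R
  | p :: l, R, next =>
      compare p.1 p.2 fun b => compareList l (Function.update R p b) next

theorem costLe_compareList {next : (Fin n × Fin n → Bool) → RandAlg n} {N : ℕ}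
    (h : ∀ R, (next R).CostLe N) (l : List (Fin n × Fin n)) (R : Fin n × Fin n → Bool) :
    (compareList l R next).CostLe (l.length + N) := by
  induction l generalizing R with
  | nil => simpa [compareList] using h R
  | cons p l ih =>
    rw [compareList, List.length_cons, Nat.add_right_comm]
    exact costLe_compare fun b => ih _

theorem failLe_compareList (hδ : 0 ≤ δ) {next : (Fin n × Fin n → Bool) → RandAlg n} {ε : ℝ≥0∞}
    (l : List (Fin n × Fin n)) (R : Fin n × Fin n → Bool)
    -- The disjunct on `R` carries the induction: an answer already recorded remains allowed, even
    -- if its pair is compared again and overwritten.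
    (h : ∀ R', (∀ p, Allowed δ val p (R p) ∨ p ∈ l → Allowed δ val p (R' p)) →
      (next R').FailLe δ val S ε) :
    (compareList l R next).FailLe δ val S ε := by
  induction l generalizing R with
  | nil => exact h R (by simp)
  | cons p l ih =>
    rw [compareList]
    refine failLe_compare hδ fun b hb => ih _ fun R' hR' => h R' fun x hx => hR' x ?_
    by_cases hxp : x = p
    · subst hxp
      simpa using Or.inl hb
    · simpa [Function.update_of_ne hxp, hxp] using hx

end RandAlg

/-! ### Tournaments: few defeats, and champions in two steps -/

/-- According to the record `R` of the pairs in increasing order, `i` defeats `j`. -/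
def beats (R : Fin n × Fin n → Bool) (i j : Fin n) : Prop :=
  if i < j then R (i, j) = true else R (j, i) = false

instance (R : Fin n × Fin n → Bool) (i j : Fin n) : Decidable (beats R i j) := by
  unfold beats; infer_instance

theorem not_beats_iff (R : Fin n × Fin n → Bool) {i j : Fin n} (hij : i ≠ j) :
    ¬ beats R i j ↔ beats R j i := by
  unfold beats
  rcases lt_or_gt_of_ne hij with h | h
  · simp [h, h.not_gt]
  · simp [h, h.not_gt]

/-- The pairs in increasing order of elements of `X` that are in the same group. -/
def matchups {γ : Type} [DecidableEq γ] (X : Finset (Fin n)) (g : Fin n → γ) :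
    Finset (Fin n × Fin n) :=
  {p ∈ X ×ˢ X | p.1 < p.2 ∧ g p.1 = g p.2}

/-- The members of the group of `i` within `X` that defeat `i`. -/
def defeaters {γ : Type} [DecidableEq γ] (R : Fin n × Fin n → Bool) (X : Finset (Fin n))
    (g : Fin n → γ) (i : Fin n) : Finset (Fin n) :=
  {j ∈ X | j ≠ i ∧ g j = g i ∧ beats R j i}

/-- The elements of `X` that are defeated fewer than `k` times within their group. -/
def survivors {γ : Type} [DecidableEq γ] (k : ℕ) (R : Fin n × Fin n → Bool) (X : Finset (Fin n))
    (g : Fin n → γ) : Finset (Fin n) :=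
  {i ∈ X | (defeaters R X g i).card < k}

theorem survivors_subset {γ : Type} [DecidableEq γ] (k : ℕ) (R : Fin n × Fin n → Bool)
    (X : Finset (Fin n)) (g : Fin n → γ) : survivors k R X g ⊆ X :=
  Finset.filter_subset _ _

theorem le_add_of_beats {δ : ℝ} {val : Fin n → ℝ} {γ : Type} [DecidableEq γ]
    {X : Finset (Fin n)} {g : Fin n → γ} {R : Fin n × Fin n → Bool}
    (hR : ∀ p ∈ matchups X g, Allowed δ val p (R p)) {i j : Fin n} (hi : i ∈ X) (hj : j ∈ X)
    (hij : i ≠ j) (hg : g i = g j) (hb : beats R i j) : val j ≤ val i + δ := by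
  unfold beats at hb
  rcases lt_or_gt_of_ne hij with h | h
  · rw [if_pos h] at hb
    exact (hR (i, j) (by simp [matchups, *])).1 hb
  · rw [if_neg h.not_gt] at hb
    exact (hR (j, i) (by simp [matchups, *])).2 hb

theorem two_mul_card_filter_offDiag (U : Finset (Fin n)) (P : Fin n → Fin n → Prop)
    [DecidableRel P] (hP : ∀ i j, i ≠ j → (¬ P i j ↔ P j i)) :
    2 * ({p ∈ U.offDiag | P p.1 p.2}).card = U.card * U.card - U.card := by
  rw [← Finset.offDiag_card, ← Finset.card_filter_add_card_filter_not (s := U.offDiag)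
    (fun p => P p.1 p.2), two_mul]
  congr 1
  refine Finset.card_bij' (fun p _ => p.swap) (fun p _ => p.swap) ?_ ?_ (by simp) (by simp)
  · rintro ⟨i, j⟩ h
    simp only [Finset.mem_filter, Finset.mem_offDiag, Prod.swap_prod_mk] at h ⊢
    refine ⟨⟨h.1.2.1, h.1.1, h.1.2.2.symm⟩, ?_⟩
    rw [hP j i h.1.2.2.symm]; exact h.2
  · rintro ⟨i, j⟩ h
    simp only [Finset.mem_filter, Finset.mem_offDiag, Prod.swap_prod_mk] at h ⊢
    refine ⟨⟨h.1.2.1, h.1.1, h.1.2.2.symm⟩, ?_⟩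
    rw [← hP i j h.1.2.2]; exact h.2

/-- At most `2 k` players of a group are defeated fewer than `k` times in its round robin. -/
theorem card_le_of_few_defeats (R : Fin n × Fin n → Bool) (U : Finset (Fin n)) (k : ℕ)
    (h : ∀ i ∈ U, ({j ∈ U | j ≠ i ∧ beats R j i}).card < k) : U.card ≤ 2 * k := by
  -- Double counting of defeats: there are `|U| (|U| - 1) / 2` in all and at most `k - 1` per
  -- player.
  have h1 := two_mul_card_filter_offDiag U (fun i j => beats R j i)
    (fun i j hij => not_beats_iff R hij.symm)
  have h2 : ({p ∈ U.offDiag | beats R p.2 p.1}).card ≤ U.card * (k - 1) := by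
    rw [Finset.card_eq_sum_card_fiberwise (f := Prod.fst) (t := U)
      (fun p hp => by simp at hp ⊢; exact hp.1.1), ← smul_eq_mul]
    refine Finset.sum_le_card_nsmul _ _ _ fun i hi => ?_
    refine le_trans ?_ (Nat.le_sub_one_of_lt (h i hi))
    refine Finset.card_le_card_of_injOn Prod.snd ?_ ?_
    · rintro ⟨a, b⟩ hp
      simp only [Finset.coe_filter, Finset.mem_filter, Finset.mem_offDiag, Set.mem_ofPred_eq] at hp ⊢
      obtain ⟨⟨⟨ha, hb, hab⟩, hbt⟩, rfl⟩ := hp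
      exact ⟨hb, hab.symm, hbt⟩
    · rintro ⟨a, b⟩ hp ⟨a', b'⟩ hp' hbb
      simp only [Finset.coe_filter, Set.mem_ofPred_eq] at hp hp' hbb
      rw [Prod.mk.injEq]; exact ⟨hp.2.trans hp'.2.symm, hbb⟩
  rcases Nat.eq_zero_or_pos U.card with h0 | h0
  · omega
  obtain ⟨i, hi⟩ := Finset.card_pos.1 h0
  have hk := h i hi
  have h3 : U.card * (U.card - 1) ≤ U.card * (2 * (k - 1)) := by
    rw [Nat.mul_sub_one, ← h1]; nlinarith
  have := Nat.le_of_mul_le_mul_left h3 h0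
  omega

/-- Among the survivors of one group, a player has no more defeats than in the whole group, so
`card_le_of_few_defeats` applies to each group. -/
theorem card_survivors_le {q : ℕ} (k : ℕ) (R : Fin n × Fin n → Bool) (X : Finset (Fin n))
    (g : Fin n → Fin q) : (survivors k R X g).card ≤ q * (2 * k) := by
  rw [Finset.card_eq_sum_card_fiberwise (f := g) (t := Finset.univ) (fun _ _ => by simp)]
  refine (Finset.sum_le_card_nsmul _ _ (2 * k) fun a _ => ?_).trans (by simp)
  refine card_le_of_few_defeats R _ k fun i hi => ?_
  rw [Finset.mem_filter] at hi
  refine lt_of_le_of_lt (Finset.card_le_card fun j hj => ?_) (Finset.mem_filter.1 hi.1).2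
  rw [Finset.mem_filter, Finset.mem_filter] at hj
  exact Finset.mem_filter.2
    ⟨survivors_subset _ _ _ _ hj.1.1, hj.2.1, hj.1.2.trans hi.2.symm, hj.2.2⟩

theorem two_mul_card_matchups_le {q : ℕ} (s : ℕ) (X : Finset (Fin n)) (g : Fin n → Fin q)
    (hs : ∀ a, ({i ∈ X | g i = a}).card ≤ s) : 2 * (matchups X g).card ≤ q * (s * s) := by
  rw [Finset.card_eq_sum_card_fiberwise (f := fun p => g p.1) (t := Finset.univ)
    (fun _ _ => by simp), Finset.mul_sum]
  refine (Finset.sum_le_card_nsmul _ _ (s * s) fun a _ => ?_).trans (by simp)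
  have h1 := two_mul_card_filter_offDiag {i ∈ X | g i = a} (fun i j => i < j)
    (fun i j hij => by rw [not_lt]; exact ⟨fun h => lt_of_le_of_ne h hij.symm, le_of_lt⟩)
  refine le_trans ?_ (Nat.mul_le_mul (hs a) (hs a))
  refine le_trans ?_ (Nat.sub_le _ (({i ∈ X | g i = a}).card))
  rw [← h1]
  refine Nat.mul_le_mul_left 2 (Finset.card_le_card fun p hp => ?_)
  simp only [matchups, Finset.mem_filter, Finset.mem_product, Finset.mem_offDiag] at hp ⊢
  exact ⟨⟨⟨hp.1.1.1, hp.2⟩, ⟨hp.1.1.2, hp.1.2.2 ▸ hp.2⟩, hp.1.2.1.ne⟩, hp.1.2.1⟩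

/-- Take `w` with the most wins. A player `y` not reached in two steps would defeat `w` and everyone
whom `w` defeats, hence have more wins. -/
theorem exists_two_step_champion (R : Fin n × Fin n → Bool) (Y : Finset (Fin n))
    (hY : Y.Nonempty) :
    ∃ w ∈ Y, ∀ y ∈ Y, y ≠ w → beats R w y ∨ ∃ z ∈ Y, z ≠ w ∧ z ≠ y ∧ beats R w z ∧ beats R z y := by
  obtain ⟨w, hw, hmax⟩ := Y.exists_max_image (fun i => ({j ∈ Y | j ≠ i ∧ beats R i j}).card) hY
  refine ⟨w, hw, fun y hy hyw => ?_⟩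
  by_contra! hcon
  have hyw' : beats R y w := (not_beats_iff R hyw.symm).1 hcon.1
  refine (hmax y hy).not_gt (Finset.card_lt_card ?_)
  rw [Finset.ssubset_iff_of_subset]
  · exact ⟨w, by simp [hw, hyw.symm, hyw'], by simp⟩
  · intro z hz
    simp only [Finset.mem_filter] at hz ⊢
    have hzy : z ≠ y := by
      rintro rfl
      exact hcon.1 hz.2.2
    exact ⟨hz.1, hzy, (not_beats_iff R hzy).1 (hcon.2 z hz.1 hz.2.1 hzy hz.2.2)⟩

/-- A player of `Y` that defeats every other one directly or in two steps. -/
noncomputable def champion (i₀ : Fin n) (R : Fin n × Fin n → Bool) (Y : Finset (Fin n)) : Fin n :=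
  if hY : Y.Nonempty then (exists_two_step_champion R Y hY).choose else i₀

theorem le_val_champion {δ : ℝ} (hδ : 0 ≤ δ) {val : Fin n → ℝ} (i₀ : Fin n)
    {Y : Finset (Fin n)} {R : Fin n × Fin n → Bool}
    (hR : ∀ p ∈ matchups Y (fun _ => (0 : Fin 1)), Allowed δ val p (R p)) {y : Fin n}
    (hy : y ∈ Y) : val y ≤ val (champion i₀ R Y) + 2 * δ := by
  have hY : Y.Nonempty := ⟨y, hy⟩
  rw [champion, dif_pos hY]
  obtain ⟨hw, h⟩ := (exists_two_step_champion R Y hY).choose_spec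
  set w := (exists_two_step_champion R Y hY).choose
  rcases eq_or_ne y w with h0 | h0
  · rw [h0]; linarith
  rcases h y hy h0 with h1 | ⟨z, hz, hzw, hzy, h1, h2⟩
  · have := le_add_of_beats hR hw hy h0.symm rfl h1
    linarith
  · have := le_add_of_beats hR hw hz hzw.symm rfl h1
    have := le_add_of_beats hR hz hy hzy rfl h2
    linarith

namespace RandAlg

/-- Play all pairs of elements of `Y` and output a champion. -/
noncomputable def roundRobin (i₀ : Fin n) (Y : Finset (Fin n)) : RandAlg n :=
  compareList (matchups Y (fun _ => (0 : Fin 1))).toList (fun _ => true)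
    fun R => output (champion i₀ R Y)

theorem costLe_roundRobin (i₀ : Fin n) (Y : Finset (Fin n)) {M : ℕ} (hM : Y.card ≤ M) :
    (roundRobin i₀ Y).CostLe (M * M / 2) := by
  refine (costLe_compareList (N := 0) (fun R => costLe_output _ _) _ _).mono ?_
  have := two_mul_card_matchups_le M Y (fun _ => (0 : Fin 1))
    (fun a => (Finset.card_filter_le _ _).trans hM)
  rw [Finset.length_toList]
  omega

/-- The three `δ`: one from `x` to `y`, two from `y` to the champion. -/
theorem failLe_roundRobin {δ : ℝ} (hδ : 0 ≤ δ) {val : Fin n → ℝ} (i₀ : Fin n)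
    {Y : Finset (Fin n)} {x y : Fin n} (hx : ∀ j, val j ≤ val x) (hy : y ∈ Y)
    (hxy : val x ≤ val y + δ) :
    (roundRobin i₀ Y).FailLe δ val {i | IsKMax 3 δ val i} 0 := by
  refine failLe_compareList hδ _ _ fun R hR => failLe_output ?_
  have := le_val_champion hδ i₀ (fun p hp => hR p (Or.inr (Finset.mem_toList.2 hp))) hy
  intro j
  have := hx j
  push_cast
  linarith

end RandAlg

/-! ### Random groups by cyclic shifts of the columns of a table -/

theorem exists_position (s : ℕ) [NeZero s] (X : Finset (Fin n)) :
    ∃ f : Fin n → Fin s × Fin (X.card / s + 1), Set.InjOn f X := by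
  have hcard : Fintype.card X ≤ Fintype.card (Fin s × Fin (X.card / s + 1)) := by
    simp only [Fintype.card_coe, Fintype.card_prod, Fintype.card_fin]
    exact (Nat.lt_mul_div_succ _ (Nat.pos_of_ne_zero (NeZero.ne s))).le
  obtain ⟨e⟩ := Function.Embedding.nonempty_of_card_le hcard
  classical
  refine ⟨fun i => if h : i ∈ X then e ⟨i, h⟩ else (0, 0), fun i hi j hj hij => ?_⟩
  rw [Finset.mem_coe] at hi hj
  simp only [dif_pos hi, dif_pos hj] at hij
  simpa using e.injective hij

/-- An arrangement of the elements of `X` in a table with `s` columns. -/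
noncomputable def position (s : ℕ) [NeZero s] (X : Finset (Fin n)) :
    Fin n → Fin s × Fin (X.card / s + 1) :=
  (exists_position s X).choose

/-- The group of an element after a cyclic shift of the columns by `o`: its row. -/
noncomputable def group (s : ℕ) [NeZero s] (X : Finset (Fin n))
    (o : Fin s → Fin (X.card / s + 1)) (i : Fin n) : Fin (X.card / s + 1) :=
  (position s X i).2 - o (position s X i).1

/-- A shift permutes each column, so two elements of one column never meet. Hence a group has at
most one player per column. -/
theorem eq_of_group_eq {s : ℕ} [NeZero s] {X : Finset (Fin n)} {o : Fin s → Fin (X.card / s + 1)}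
    {i j : Fin n} (hi : i ∈ X) (hj : j ∈ X) (hg : group s X o i = group s X o j)
    (hc : (position s X i).1 = (position s X j).1) : i = j := by
  refine (exists_position s X).choose_spec hi hj (Prod.ext hc ?_)
  unfold group at hg
  rw [hc] at hg
  exact sub_left_injective hg

theorem card_group_le (s : ℕ) [NeZero s] (X : Finset (Fin n)) (o : Fin s → Fin (X.card / s + 1))
    (a : Fin (X.card / s + 1)) : ({i ∈ X | group s X o i = a}).card ≤ s := by
  refine (Finset.card_le_card_of_injOn (t := Finset.univ) (fun i => (position s X i).1)
    (by simp) fun i hi j hj hij => ?_).trans (by simp)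
  rw [Finset.mem_coe, Finset.mem_filter] at hi hj
  exact eq_of_group_eq hi.1 hj.1 (hi.2.trans hj.2.symm) hij

/-- With `q` rows, all of `S` joins `x` with probability at most `q ^ (-|S|)`. If this is possible
at all, the elements of `S` and `x` lie in distinct columns, and the shift of the column of `x`
determines those of the columns of `S`. -/
theorem card_shifts_mul_le {s : ℕ} [NeZero s] {X S : Finset (Fin n)} {x : Fin n} (hx : x ∈ X)
    (hS : S ⊆ X) (hxS : x ∉ S) :
    ({o : Fin s → Fin (X.card / s + 1) | ∀ j ∈ S, group s X o j = group s X o x} :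
      Finset _).card * (X.card / s + 1) ^ S.card ≤ (X.card / s + 1) ^ s := by
  classical
  set q := X.card / s + 1 with hq
  rcases Finset.eq_empty_or_nonempty
    ({o : Fin s → Fin q | ∀ j ∈ S, group s X o j = group s X o x} : Finset _) with h0 | ⟨o₀, ho₀⟩
  · rw [h0]; simp
  rw [Finset.mem_filter] at ho₀
  set col : Fin n → Fin s := fun i => (position s X i).1 with hcol
  have hinj : Set.InjOn col S := fun i hi j hj hij =>
    eq_of_group_eq (hS hi) (hS hj) ((ho₀.2 i hi).trans (ho₀.2 j hj).symm) hij
  have hcx : col x ∉ S.image col := by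
    intro h
    obtain ⟨j, hj, hjx⟩ := Finset.mem_image.1 h
    exact hxS (eq_of_group_eq (hS hj) hx (ho₀.2 j hj) hjx ▸ hj)
  have hT : (S.image col).card = S.card := Finset.card_image_of_injOn hinj
  have hle : S.card ≤ s := by
    rw [← hT]; exact (Finset.card_le_univ _).trans (by simp)
  -- A favourable shift is recovered from its restriction to the columns that do not meet `S`, among
  -- them that of `x`.
  have hcard : ({o : Fin s → Fin q | ∀ j ∈ S, group s X o j = group s X o x} : Finset _).card ≤
      (Finset.univ : Finset ({c : Fin s // c ∉ S.image col} → Fin q)).card := by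
    refine Finset.card_le_card_of_injOn (fun o c => o c) (by simp) fun o ho o' ho' hoo => ?_
    rw [Finset.mem_coe, Finset.mem_filter] at ho ho'
    have hout : ∀ c, c ∉ S.image col → o c = o' c := fun c hc => congrFun hoo ⟨c, hc⟩
    funext c
    by_cases hc : c ∈ S.image col
    · obtain ⟨j, hj, rfl⟩ := Finset.mem_image.1 hc
      have h1 := ho.2 j hj
      have h2 := ho'.2 j hj
      unfold group at h1 h2
      have h3 := hout _ hcx
      simp only [hcol] at h3 ⊢
      rw [h3, ← h2] at h1
      exact sub_right_injective h1
    · exact hout c hc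
  have hcomp : (Finset.univ : Finset ({c : Fin s // c ∉ S.image col} → Fin q)).card =
      q ^ (s - S.card) := by
    rw [Finset.card_univ, Fintype.card_fun, Fintype.card_fin, Fintype.card_subtype_compl,
      Fintype.card_coe, Fintype.card_fin, hT]
  calc _ ≤ q ^ (s - S.card) * q ^ S.card := Nat.mul_le_mul_right _ (hcard.trans hcomp.le)
    _ = q ^ s := by rw [← pow_add, Nat.sub_add_cancel hle]

theorem card_crowded_shifts_mul_le {s : ℕ} [NeZero s] {X B : Finset (Fin n)} {x : Fin n}
    (k : ℕ) (hx : x ∈ X) (hB : B ⊆ X) (hxB : x ∉ B) :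
    ({o : Fin s → Fin (X.card / s + 1) | k ≤ ({j ∈ B | group s X o j = group s X o x}).card} :
      Finset _).card * (X.card / s + 1) ^ k ≤ B.card.choose k * (X.card / s + 1) ^ s := by
  classical
  have hsub : ({o : Fin s → Fin (X.card / s + 1) |
      k ≤ ({j ∈ B | group s X o j = group s X o x}).card} : Finset _) ⊆
      (B.powersetCard k).biUnion fun S =>
        {o : Fin s → Fin (X.card / s + 1) | ∀ j ∈ S, group s X o j = group s X o x} := by
    intro o ho
    rw [Finset.mem_filter] at ho
    obtain ⟨S, hS, hSk⟩ := Finset.exists_subset_card_eq ho.2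
    refine Finset.mem_biUnion.2 ⟨S, Finset.mem_powersetCard.2
      ⟨hS.trans (Finset.filter_subset _ _), hSk⟩, ?_⟩
    rw [Finset.mem_filter]
    exact ⟨Finset.mem_univ _, fun j hj => (Finset.mem_filter.1 (hS hj)).2⟩
  refine (Nat.mul_le_mul_right _ ((Finset.card_le_card hsub).trans Finset.card_biUnion_le)).trans ?_
  rw [Finset.sum_mul, ← Finset.card_powersetCard, ← smul_eq_mul]
  refine Finset.sum_le_card_nsmul _ _ _ fun S hS => ?_
  rw [Finset.mem_powersetCard] at hS
  have := card_shifts_mul_le (s := s) hx (hS.1.trans hB) (fun h => hxB (hS.1 h))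
  rwa [hS.2] at this

theorem card_missing_samples (t : ℕ) {X B : Finset (Fin n)} (hB : B ⊆ X) :
    ({a : Fin t → X | ∀ i, (a i : Fin n) ∉ B} : Finset _).card = (X.card - B.card) ^ t := by
  classical
  have : ({a : Fin t → X | ∀ i, (a i : Fin n) ∉ B} : Finset _) =
      Fintype.piFinset fun _ => ({y : X | (y : Fin n) ∉ B} : Finset X) := by
    ext a; simp [Fintype.mem_piFinset]
  rw [this, Fintype.card_piFinset, Finset.prod_const, Finset.card_univ, Fintype.card_fin,
    ← Finset.card_sdiff_of_subset hB]
  congr 1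
  refine Finset.card_bij (fun y _ => (y : Fin n)) ?_ ?_ ?_
  · intro y hy
    simp only [Finset.mem_filter] at hy
    simp [hy.2]
  · intro y _ z _ h; exact Subtype.ext h
  · intro y hy
    rw [Finset.mem_sdiff] at hy
    exact ⟨⟨y, hy.1⟩, by simp [hy.2], rfl⟩

/-! ### The elimination procedure: cost and failure probability -/

namespace RandAlg

/-- Repeatedly sample `t` elements of `X` and reduce `X` by random group tournaments with at most
`s` players, keeping the players with fewer than `k` defeats. Once `X` has at most `t` elements,
or after `f` repetitions, play all pairs of the elements sampled or left. -/
noncomputable def eliminate (t s k : ℕ) [NeZero s] (i₀ : Fin n) :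
    ℕ → Finset (Fin n) → Finset (Fin n) → RandAlg n
  | 0, X, W => roundRobin i₀ (X ∪ W)
  | f + 1, X, W =>
    if h : X.card ≤ t then roundRobin i₀ (X ∪ W)
    else
      haveI : Nonempty X := (Finset.card_pos.1 (by omega)).to_subtype
      drawFrom (Fin t → X) fun a =>
        drawFrom (Fin s → Fin (X.card / s + 1)) fun o =>
          compareList (matchups X (group s X o)).toList (fun _ => true) fun R =>
            eliminate t s k i₀ f (survivors k R X (group s X o))
              (W ∪ Finset.univ.image fun i => (a i : Fin n))

/-- The potential is `s |X|`. With `m = |X|`, a round makes at most `s (m + s) / 2` comparisons and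
leaves at most `2 (m + s) / 5` elements, so both charges sum to `9 s (m + s) / 10`. This is at most
`s m` because `9 s ≤ t < m`. -/
theorem costLe_eliminate {t s k : ℕ} [NeZero s] (hs : s = 5 * k) (ht : 9 * s ≤ t) (i₀ : Fin n)
    (f : ℕ) (X W : Finset (Fin n)) (hX : X.card ≤ t * 2 ^ f) :
    (eliminate t s k i₀ f X W).CostLe
      (s * X.card + (W.card + (f + 1) * t) * (W.card + (f + 1) * t) / 2) := by
  -- In `f + 1`, one `t` accounts for the elements left in `X`, the other `f` for samples still to
  -- be drawn.
  have done_of_le : ∀ (f : ℕ) (X W : Finset (Fin n)), X.card ≤ t → (roundRobin i₀ (X ∪ W)).CostLe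
      (s * X.card + (W.card + (f + 1) * t) * (W.card + (f + 1) * t) / 2) := by
    intro f X W hXt
    refine (costLe_roundRobin i₀ (X ∪ W) ?_).mono (Nat.le_add_left _ _)
    have := Finset.card_union_le X W
    nlinarith
  induction f generalizing X W with
  | zero => rw [eliminate]; exact done_of_le 0 X W (by simpa using hX)
  | succ f ih =>
    rw [eliminate]
    split_ifs with h
    · exact done_of_le _ X W h
    have : Nonempty X := (Finset.card_pos.1 (by omega)).to_subtype
    refine costLe_drawFrom fun a => costLe_drawFrom fun o => ?_
    have hqs : (X.card / s + 1) * s ≤ X.card + s := by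
      rw [add_mul, one_mul]; exact Nat.add_le_add_right (Nat.div_mul_le_self _ _) _
    have hp := two_mul_card_matchups_le s X (group s X o) (card_group_le s X o)
    have hsurv : ∀ R, 5 * (survivors k R X (group s X o)).card ≤ 2 * (X.card + s) := by
      intro R
      have := card_survivors_le k R X (group s X o)
      calc 5 * _ ≤ 5 * ((X.card / s + 1) * (2 * k)) := Nat.mul_le_mul_left 5 this
        _ = 2 * ((X.card / s + 1) * (5 * k)) := by ring
        _ ≤ 2 * (X.card + s) := by rw [← hs]; exact Nat.mul_le_mul_left 2 hqs
    have hp2 : 2 * (matchups X (group s X o)).card ≤ s * (X.card + s) := by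
      refine hp.trans ?_
      rw [← mul_assoc, mul_comm]
      exact Nat.mul_le_mul_left s hqs
    set p := (matchups X (group s X o)).card with hpdef
    set M := W.card + (f + 1 + 1) * t with hM
    have hle : p + (s * X.card - p) = s * X.card := by
      refine Nat.add_sub_cancel' ?_
      nlinarith
    have hcost := costLe_compareList (N := s * X.card - p + M * M / 2)
      (next := fun R => eliminate t s k i₀ f (survivors k R X (group s X o))
              (W ∪ Finset.univ.image fun i => (a i : Fin n))) (fun R => ?_)
      (matchups X (group s X o)).toList (fun _ => true)
    · rw [Finset.length_toList, ← hpdef, ← add_assoc, hle] at hcost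
      exact hcost
    set m' := (survivors k R X (group s X o)).card with hm'
    have h5 := hsurv R
    have hW : (W ∪ Finset.univ.image fun i => (a i : Fin n)).card ≤ W.card + t :=
      (Finset.card_union_le _ _).trans (Nat.add_le_add_left
        (Finset.card_image_le.trans (by simp)) _)
    have hm2 : m' ≤ t * 2 ^ f := by
      have : X.card ≤ 2 * (t * 2 ^ f) := by rw [pow_succ] at hX; linarith
      omega
    refine (ih _ _ hm2).mono (Nat.add_le_add ?_ (Nat.div_le_div_right ?_))
    · have h6 : s * (5 * m') ≤ s * (2 * (X.card + s)) := Nat.mul_le_mul_left s h5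
      have h7 : s * (9 * (X.card + s)) ≤ s * (10 * X.card) := Nat.mul_le_mul_left s (by omega)
      have : p + s * m' ≤ s * X.card := by linarith
      exact Nat.le_sub_of_add_le' this
    · have : (W ∪ Finset.univ.image fun i => (a i : Fin n)).card + (f + 1) * t ≤ M := by
        rw [hM]; linarith
      exact Nat.mul_le_mul this this

theorem cast_le_inv_mul {a N K : ℕ} (hN : N ≠ 0) (h : a * N ≤ K) :
    (a : ℝ≥0∞) ≤ (N : ℝ≥0∞)⁻¹ * K := by
  rw [mul_comm, ← div_eq_mul_inv, ENNReal.le_div_iff_mul_le (by simp [hN]) (by simp)]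
  exact_mod_cast h

/-- The invariant is `hXW`: the maximum is in play or nearly attained in the samples, and the latter
persists as `W` only grows. Each round breaks it with probability at most `1 / N`. Stopping early is
harmless here; only the cost needs `X` to be small at the end. -/
theorem failLe_eliminate {δ : ℝ} (hδ : 0 ≤ δ) {val : Fin n → ℝ} {x : Fin n}
    (hx : ∀ j, val j ≤ val x) {t s k D N : ℕ} [NeZero s] (hN : N ≠ 0)
    (hsample : ∀ b m : ℕ, t < m → b ≤ m → m < b * D → (m - b) ^ t * N ≤ m ^ t)
    (hshift : ∀ b m : ℕ, t < m → b * D ≤ m → b.choose k * N ≤ (m / s + 1) ^ k)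
    (i₀ : Fin n) (f : ℕ) (X W : Finset (Fin n)) (hXW : x ∈ X ∨ ∃ w ∈ W, val x ≤ val w + δ) :
    (eliminate t s k i₀ f X W).FailLe δ val {i | IsKMax 3 δ val i} (f * (N : ℝ≥0∞)⁻¹) := by
  have done_of_le : ∀ X W : Finset (Fin n), (x ∈ X ∨ ∃ w ∈ W, val x ≤ val w + δ) →
      (roundRobin i₀ (X ∪ W)).FailLe δ val {i | IsKMax 3 δ val i} 0 := by
    rintro X W (h | ⟨w, hw, h⟩)
    · exact failLe_roundRobin hδ i₀ hx (Finset.mem_union_left _ h) (by linarith)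
    · exact failLe_roundRobin hδ i₀ hx (Finset.mem_union_right _ hw) h
  induction f generalizing X W with
  | zero => rw [eliminate]; exact (done_of_le X W hXW).mono (by simp)
  | succ f ih =>
    rw [eliminate]
    split_ifs with h
    · exact (done_of_le X W hXW).mono (by simp)
    rw [not_le] at h
    have : Nonempty X := (Finset.card_pos.1 (by omega)).to_subtype
    classical
    -- The bad draws are chosen before `R` is quantified, so they work against every allowed record.
    -- Only one of the two sets is ever nonempty, according to the density of `B`.
    obtain ⟨bad₁, bad₂, η₁, η₂, hη, h₁, h₂, hgood⟩ : ∃ (bad₁ : Finset (Fin t → X))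
        (bad₂ : Finset (Fin s → Fin (X.card / s + 1))) (η₁ η₂ : ℝ≥0∞), η₁ + η₂ ≤ (N : ℝ≥0∞)⁻¹ ∧
        (bad₁.card : ℝ≥0∞) ≤ η₁ * Fintype.card (Fin t → X) ∧
        (bad₂.card : ℝ≥0∞) ≤ η₂ * Fintype.card (Fin s → Fin (X.card / s + 1)) ∧
        ∀ a ∉ bad₁, ∀ o ∉ bad₂, ∀ R : Fin n × Fin n → Bool,
          (∀ p ∈ matchups X (group s X o), Allowed δ val p (R p)) →
          (x ∈ survivors k R X (group s X o) ∨
            ∃ w ∈ W ∪ Finset.univ.image fun i => (a i : Fin n), val x ≤ val w + δ) := by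
      rcases hXW with hxX | ⟨w, hw, hwx⟩
      swap
      · exact ⟨∅, ∅, 0, 0, by simp, by simp, by simp, fun a _ o _ R _ =>
          Or.inr ⟨w, Finset.mem_union_left _ hw, hwx⟩⟩
      set B : Finset (Fin n) := {i ∈ X | val x ≤ val i + δ} with hB
      have hBX : B ⊆ X := Finset.filter_subset _ _
      by_cases hdense : X.card < B.card * D
      · refine ⟨Finset.univ.filter fun a : Fin t → X => ∀ i, (a i : Fin n) ∉ B, ∅, (N : ℝ≥0∞)⁻¹, 0, by simp, ?_,
          by simp, fun a ha o _ R _ => Or.inr ?_⟩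
        · refine cast_le_inv_mul hN ?_
          rw [card_missing_samples t hBX, Fintype.card_fun, Fintype.card_fin, Fintype.card_coe]
          exact hsample _ _ h (Finset.card_le_card hBX) hdense
        · simp only [Finset.mem_filter, Finset.mem_univ, true_and, not_forall, not_not] at ha
          obtain ⟨i, hi⟩ := ha
          exact ⟨a i, Finset.mem_union_right _ (Finset.mem_image_of_mem _ (Finset.mem_univ i)),
            (Finset.mem_filter.1 hi).2⟩
      · refine ⟨∅, Finset.univ.filter fun o : Fin s → Fin (X.card / s + 1) =>
          k ≤ ({j ∈ B.erase x | group s X o j = group s X o x}).card, 0, (N : ℝ≥0∞)⁻¹, by simp,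
          by simp, ?_, fun a _ o ho R hR => Or.inl ?_⟩
        · refine cast_le_inv_mul hN ?_
          rw [Fintype.card_fun, Fintype.card_fin, Fintype.card_fin]
          have h1 := card_crowded_shifts_mul_le (s := s) (B := B.erase x) k hxX
            ((Finset.erase_subset _ _).trans hBX) (Finset.notMem_erase _ _)
          have h2 := hshift (B.erase x).card X.card h
            ((Nat.mul_le_mul_right D (Finset.card_erase_le)).trans (not_lt.1 hdense))
          refine Nat.le_of_mul_le_mul_left ?_ (pow_pos (Nat.succ_pos (X.card / s)) k)
          refine le_trans (le_of_eq ?_) ((Nat.mul_le_mul_right N h1).trans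
            (le_trans (le_of_eq ?_) (Nat.mul_le_mul_right _ h2)))
          · rw [Nat.succ_eq_add_one]; ring
          · ring
        · simp only [Finset.mem_filter, Finset.mem_univ, true_and, not_le] at ho
          refine Finset.mem_filter.2 ⟨hxX, lt_of_le_of_lt (Finset.card_le_card fun j hj => ?_) ho⟩
          rw [defeaters, Finset.mem_filter] at hj
          obtain ⟨hjX, hjx, hg, hb⟩ := hj
          rw [Finset.mem_filter, Finset.mem_erase, hB, Finset.mem_filter]
          exact ⟨⟨hjx, hjX, le_add_of_beats hR hjX hxX hjx hg hb⟩, hg⟩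
    refine (failLe_drawFrom (ε := η₂ + f * (N : ℝ≥0∞)⁻¹) bad₁ h₁ fun a ha =>
      failLe_drawFrom bad₂ h₂ fun o ho => failLe_compareList hδ _ _ fun R hR =>
        ih _ _ (hgood a ha o ho R fun p hp => hR p (Or.inr (Finset.mem_toList.2 hp)))).mono ?_
    calc η₁ + (η₂ + f * (N : ℝ≥0∞)⁻¹) = (η₁ + η₂) + f * (N : ℝ≥0∞)⁻¹ := by ring
      _ ≤ (N : ℝ≥0∞)⁻¹ + f * (N : ℝ≥0∞)⁻¹ := by gcongr
      _ = _ := by push_cast; ring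

end RandAlg

/-! ### Numerical estimates -/

/-- Each sample misses with probability at most `1 - 1 / D ≤ exp (-1 / D)`; the exponent turns this
into `exp (-(c + 1) ℓ)`, and `n ≤ 2 ^ ℓ ≤ exp ℓ`. -/
theorem pow_missing_le {n c ℓ D : ℕ} (hn : n ≤ 2 ^ ℓ) (hD : 0 < D) {b m : ℕ} (hbm : b ≤ m)
    (h : m < b * D) :
    (m - b) ^ (D * ((c + 1) * ℓ)) * n ^ (c + 1) ≤ m ^ (D * ((c + 1) * ℓ)) := by
  have hb : 0 < b := Nat.pos_of_ne_zero (by rintro rfl; simp at h)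
  have hm : (0 : ℝ) < m := by exact_mod_cast hb.trans_le hbm
  have hD' : (0 : ℝ) < D := by exact_mod_cast hD
  have h1 : ((m - b : ℕ) : ℝ) ≤ m * Real.exp (-(1 / D)) := by
    rw [Nat.cast_sub hbm]
    have h2 : (1 : ℝ) / D ≤ b / m := by
      rw [div_le_div_iff₀ hD' hm]
      have : (m : ℝ) < b * D := by exact_mod_cast h
      linarith
    calc (m : ℝ) - b = m * (1 - b / m) := by field_simp
      _ ≤ m * Real.exp (-(b / m)) := by gcongr; exact Real.one_sub_le_exp_neg _
      _ ≤ m * Real.exp (-(1 / D)) := by gcongr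
  have h3 : (n : ℝ) ≤ Real.exp ℓ := by
    calc (n : ℝ) ≤ 2 ^ ℓ := by exact_mod_cast hn
      _ ≤ Real.exp 1 ^ ℓ := by gcongr; linarith [Real.exp_one_gt_d9]
      _ = Real.exp ℓ := by rw [← Real.exp_nat_mul, mul_one]
  have h4 : (((m - b : ℕ) : ℝ)) ^ (D * ((c + 1) * ℓ)) * (n : ℝ) ^ (c + 1) ≤
      (m : ℝ) ^ (D * ((c + 1) * ℓ)) := by
    calc _ ≤ (m * Real.exp (-(1 / D))) ^ (D * ((c + 1) * ℓ)) * Real.exp ℓ ^ (c + 1) := by gcongr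
      _ = (m : ℝ) ^ (D * ((c + 1) * ℓ)) := by
        rw [mul_pow, ← Real.exp_nat_mul, ← Real.exp_nat_mul, mul_assoc, ← Real.exp_add]
        have : ((D * ((c + 1) * ℓ) : ℕ) : ℝ) * -(1 / D) + ((c + 1 : ℕ) : ℝ) * ℓ = 0 := by
          push_cast; field_simp; ring
        rw [this, Real.exp_zero, mul_one]
  exact_mod_cast h4

/-- From `b.choose k ≤ (e b / k) ^ k` and `b ≤ 5 k q / (14 r)` the ratio to `q ^ k` is at most `(5 e
/ (14 r)) ^ k`. The constant `14` is chosen just above `5 e`, and `r ^ k ≥ n ^ (c + 1)`. -/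
theorem choose_mul_le_pow {n c r : ℕ} (hr : 0 < r) (hn : n ≤ r ^ 3) {b m : ℕ}
    (h : b * (14 * r) ≤ m) :
    b.choose (3 * (c + 2)) * n ^ (c + 1) ≤ (m / (5 * (3 * (c + 2))) + 1) ^ (3 * (c + 2)) := by
  set k := 3 * (c + 2) with hk
  set q := m / (5 * k) + 1 with hq
  have hk0 : 0 < k := by omega
  have hmq : m < 5 * k * q := Nat.lt_mul_div_succ _ (by omega)
  have hr' : (0 : ℝ) < r := by exact_mod_cast hr
  have hb : (b : ℝ) ≤ 5 * q / (14 * r) * k := by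
    rw [div_mul_eq_mul_div, le_div_iff₀ (by positivity)]
    have : b * (14 * r) ≤ 5 * k * q := h.trans hmq.le
    have : (b : ℝ) * (14 * r) ≤ 5 * k * q := by exact_mod_cast this
    linarith
  have hN : (n : ℝ) ^ (c + 1) ≤ (r : ℝ) ^ k := by
    have : n ^ (c + 1) ≤ r ^ k :=
      calc n ^ (c + 1) ≤ (r ^ 3) ^ (c + 1) := Nat.pow_le_pow_left hn _
        _ = r ^ (3 * (c + 1)) := by rw [pow_mul]
        _ ≤ r ^ k := Nat.pow_le_pow_right hr (by omega)
    exact_mod_cast this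
  have hC : (b.choose k : ℝ) ≤ (q / r : ℝ) ^ k := by
    calc (b.choose k : ℝ) ≤ (b : ℝ) ^ k / k.factorial := Nat.choose_le_pow_div k b
      _ ≤ (5 * q / (14 * r) * k) ^ k / k.factorial := by gcongr
      _ = (5 * q / (14 * r)) ^ k * ((k : ℝ) ^ k / k.factorial) := by rw [mul_pow, mul_div_assoc]
      _ ≤ (5 * q / (14 * r)) ^ k * Real.exp k := by
        gcongr; exact Real.pow_div_factorial_le_exp _ (by positivity) _
      _ = (5 * q / (14 * r) * Real.exp 1) ^ k := by
        rw [mul_pow _ (Real.exp 1), ← Real.exp_nat_mul, mul_one]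
      _ ≤ (q / r : ℝ) ^ k := by
        gcongr
        have : 5 * (q : ℝ) / (14 * r) * Real.exp 1 = q / r * (5 * Real.exp 1 / 14) := by
          field_simp
        rw [this]
        refine mul_le_of_le_one_right (by positivity) ?_
        rw [div_le_one (by norm_num)]
        linarith [Real.exp_one_lt_d9]
  have : (b.choose k : ℝ) * (n : ℝ) ^ (c + 1) ≤ (q : ℝ) ^ k := by
    calc _ ≤ (q / r : ℝ) ^ k * (r : ℝ) ^ k := by gcongr
      _ = (q : ℝ) ^ k := by rw [← mul_pow, div_mul_cancel₀ _ hr'.ne']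
  exact_mod_cast this

theorem sampleConst_pos : 0 < sampleConst := by
  unfold sampleConst; positivity

/-- Besides positivity, the only fact needed about `C`. Here `112 = 14 * 2 * 2 ^ 2` collects the
`14` of the sample size, `r ≤ 2 n^(1/3)` and `ℓ ≤ 2 ln n`. -/
theorem sampleConst_le : sampleConst ≤ 1 / 112 := by
  unfold sampleConst
  have : (10 : ℝ) ^ 5 ≤ (5 * Real.exp 1) ^ 5 := by
    gcongr; linarith [Real.exp_one_gt_d9]
  rw [div_le_div_iff₀ (by positivity) (by norm_num)]
  linarith

theorem isBigO_comparisonBound (c : ℕ) :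
    (fun n : ℕ => comparisonBound c n) =O[Filter.atTop] (fun n : ℕ => (n : ℝ)) := by
  have h1 : (fun x : ℝ => Real.log x ^ (4 : ℝ)) =o[Filter.atTop] fun x => x ^ (1 / 3 : ℝ) :=
    isLittleO_log_rpow_rpow_atTop 4 (by norm_num)
  have h2 : (fun n : ℕ => (n : ℝ) ^ (2 / 3 : ℝ) * Real.log n ^ 4) =O[Filter.atTop]
      (fun n : ℕ => (n : ℝ)) := by
    have h3 := (Asymptotics.isBigO_refl (fun n : ℕ => (n : ℝ) ^ (2 / 3 : ℝ)) Filter.atTop).mul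
      (h1.isBigO.comp_tendsto tendsto_natCast_atTop_atTop)
    refine h3.congr' (Filter.Eventually.of_forall fun n => ?_)
      (Filter.eventually_atTop.2 ⟨1, fun n hn => ?_⟩)
    · simp only [Function.comp_apply]
      norm_cast
    · have : (0 : ℝ) < n := by exact_mod_cast hn
      simp only [Function.comp_apply]
      rw [← Real.rpow_add this]
      norm_num
  unfold comparisonBound
  refine ((Asymptotics.isBigO_refl _ _).const_mul_left _).add ?_
  simp only [mul_assoc]
  exact h2.const_mul_left _

theorem le_comparisonBound {c n r ℓ : ℕ} (hn : 27 ≤ n) (hr : (r : ℝ) ≤ 2 * (n : ℝ) ^ (1 / 3 : ℝ))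
    (hℓ : 2 ^ (ℓ - 1) ≤ n) {p : ℕ}
    (hp : p ≤ 15 * (c + 2) * n +
      (ℓ * (14 * r * ((c + 1) * ℓ))) * (ℓ * (14 * r * ((c + 1) * ℓ))) / 2) :
    (p : ℝ) ≤ comparisonBound c n := by
  have hn0 : (0 : ℝ) < n := by exact_mod_cast (by omega : 0 < n)
  have hlog2 := Real.log_two_gt_d9
  have hlog2' := Real.log_two_lt_d9
  -- This absorbs the rounding in `ℓ ≤ ln n / ln 2 + 1 ≤ 2 ln n`.
  have hlog : 2 ≤ Real.log n := by
    rw [Real.le_log_iff_exp_le hn0]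
    calc Real.exp 2 = Real.exp 1 ^ 2 := by rw [← Real.exp_nat_mul]; norm_num
      _ ≤ 3 ^ 2 := by gcongr; linarith [Real.exp_one_lt_d9]
      _ ≤ (27 : ℝ) := by norm_num
      _ ≤ n := by exact_mod_cast hn
  have hℓ' : (ℓ : ℝ) ≤ 2 * Real.log n := by
    have h1 : ((ℓ - 1 : ℕ) : ℝ) * Real.log 2 ≤ Real.log n := by
      rw [← Real.log_pow]
      exact Real.log_le_log (by positivity) (by exact_mod_cast hℓ)
    have h2 : (ℓ : ℝ) ≤ ((ℓ - 1 : ℕ) : ℝ) + 1 := by exact_mod_cast (by omega : ℓ ≤ ℓ - 1 + 1)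
    nlinarith
  set E : ℝ := ((c : ℝ) + 1) / (sampleConst * Real.log 2) with hE
  have hC := sampleConst_pos
  have hCL : 112 * ((c : ℝ) + 1) ≤ E := by
    rw [hE, le_div_iff₀ (by positivity)]
    have h1 : sampleConst * Real.log 2 ≤ 1 / 112 * 1 := by
      gcongr
      · exact sampleConst_le
      · linarith
    nlinarith
  have hM : ((ℓ * (14 * r * ((c + 1) * ℓ)) : ℕ) : ℝ) ≤
      E * (n : ℝ) ^ (1 / 3 : ℝ) * Real.log n ^ 2 := by
    push_cast
    calc (ℓ : ℝ) * (14 * r * ((c + 1) * ℓ)) = 14 * (c + 1) * r * ℓ ^ 2 := by ring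
      _ ≤ 14 * (c + 1) * (2 * (n : ℝ) ^ (1 / 3 : ℝ)) * (2 * Real.log n) ^ 2 := by gcongr
      _ = 112 * ((c : ℝ) + 1) * (n : ℝ) ^ (1 / 3 : ℝ) * Real.log n ^ 2 := by ring
      _ ≤ _ := by gcongr
  have hpow : (n : ℝ) ^ (2 / 3 : ℝ) = (n : ℝ) ^ (1 / 3 : ℝ) * (n : ℝ) ^ (1 / 3 : ℝ) := by
    rw [← Real.rpow_add hn0]; norm_num
  set M := ℓ * (14 * r * ((c + 1) * ℓ))
  have hp' : (p : ℝ) ≤ 15 * (c + 2) * n + (M : ℝ) * M / 2 := by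
    calc (p : ℝ) ≤ ((15 * (c + 2) * n + M * M / 2 : ℕ) : ℝ) := by exact_mod_cast hp
      _ ≤ 15 * (c + 2) * n + (M : ℝ) * M / 2 := by
        rw [Nat.cast_add]
        have := Nat.cast_div_le (α := ℝ) (m := M * M) (n := 2)
        push_cast at this ⊢
        linarith
  have hMM := mul_le_mul hM hM (by positivity) (by positivity)
  unfold comparisonBound groupSize
  rw [← hE, hpow]
  push_cast
  calc (p : ℝ) ≤ _ := hp'
    _ ≤ 15 * (c + 2) * n + (E * (n : ℝ) ^ (1 / 3 : ℝ) * Real.log n ^ 2) *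
      (E * (n : ℝ) ^ (1 / 3 : ℝ) * Real.log n ^ 2) / 2 := by linarith
    _ = _ := by ring

theorem linear_le_comparisonBound {c n p : ℕ} (hp : p ≤ 15 * (c + 2) * n) :
    (p : ℝ) ≤ comparisonBound c n := by
  have h1 : (p : ℝ) ≤ 15 * (c + 2) * n := by exact_mod_cast hp
  have h2 : 0 ≤ (((c : ℝ) + 1) / (sampleConst * Real.log 2)) ^ 2 / 2 *
      (n : ℝ) ^ (2 / 3 : ℝ) * Real.log n ^ 4 := by positivity
  unfold comparisonBound groupSize
  push_cast
  linarith

/-! ### The algorithm and its parameters -/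

/-- The real cube root of `n`, rounded up. -/
noncomputable def ceilCbrt (n : ℕ) : ℕ := ⌈(n : ℝ) ^ (1 / 3 : ℝ)⌉₊

theorem le_ceilCbrt_pow (n : ℕ) : n ≤ ceilCbrt n ^ 3 := by
  have h : (n : ℝ) ≤ (ceilCbrt n : ℝ) ^ 3 := by
    calc (n : ℝ) = ((n : ℝ) ^ (1 / 3 : ℝ)) ^ 3 := by
          rw [← Real.rpow_natCast, ← Real.rpow_mul (by positivity)]; norm_num
      _ ≤ _ := by gcongr; exact Nat.le_ceil _
  exact_mod_cast h

theorem ceilCbrt_le {n : ℕ} (hn : 1 ≤ n) : (ceilCbrt n : ℝ) ≤ 2 * (n : ℝ) ^ (1 / 3 : ℝ) := by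
  have h1 : (1 : ℝ) ≤ (n : ℝ) ^ (1 / 3 : ℝ) :=
    Real.one_le_rpow (by exact_mod_cast hn) (by norm_num)
  have := (Nat.ceil_lt_add_one (zero_le_one.trans h1)).le
  unfold ceilCbrt
  linarith

/-- The number of elements sampled in each round, and the number of elements that ends the
elimination. -/
noncomputable def sampleSize (c n : ℕ) : ℕ :=
  14 * ceilCbrt n * ((c + 1) * (Nat.log 2 n + 1))

theorem le_sampleSize {c n : ℕ} (hc : 1 ≤ c) (hn : 27 ≤ n) : 9 * (15 * (c + 2)) ≤ sampleSize c n := by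
  have h1 : 3 ≤ ceilCbrt n := by
    by_contra! h
    have := le_ceilCbrt_pow n
    have h2 : ceilCbrt n ^ 3 ≤ 2 ^ 3 := Nat.pow_le_pow_left (by omega) _
    omega
  have h2 : 4 ≤ Nat.log 2 n := Nat.le_log_of_pow_le (by norm_num) (by omega)
  have h3 : 3 * 5 ≤ ceilCbrt n * (Nat.log 2 n + 1) := Nat.mul_le_mul h1 (by omega)
  calc 9 * (15 * (c + 2)) ≤ 14 * (c + 1) * (3 * 5) := by linarith
    _ ≤ 14 * (c + 1) * (ceilCbrt n * (Nat.log 2 n + 1)) := Nat.mul_le_mul_left _ h3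
    _ = sampleSize c n := by unfold sampleSize; ring

/-- The algorithm: a round robin on at most `26` elements, an elimination on more. -/
noncomputable def findMax (c n : ℕ) (hn : 1 ≤ n) : RandAlg n :=
  haveI : NeZero (15 * (c + 2)) := ⟨by omega⟩
  if n < 27 then RandAlg.roundRobin ⟨0, hn⟩ Finset.univ
  else RandAlg.eliminate (sampleSize c n) (15 * (c + 2)) (3 * (c + 2)) ⟨0, hn⟩ (Nat.log 2 n)
    Finset.univ ∅

theorem findMax_cost {c n : ℕ} (hc : 1 ≤ c) (hn : 1 ≤ n) {p : ℕ}
    (hp : ∀ N, (findMax c n hn).CostLe N → p ≤ N) : (p : ℝ) ≤ comparisonBound c n := by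
  unfold findMax at hp
  split_ifs at hp with h
  · have := hp _ (RandAlg.costLe_roundRobin _ _ (M := n) (by simp))
    refine linear_le_comparisonBound (this.trans ?_)
    rw [Nat.div_le_iff_le_mul_add_pred (by norm_num)]
    nlinarith
  · rw [not_lt] at h
    have : NeZero (15 * (c + 2)) := ⟨by omega⟩
    have ht := le_sampleSize hc h
    have := hp _ (RandAlg.costLe_eliminate (by ring) ht ⟨0, hn⟩ (Nat.log 2 n) Finset.univ ∅ ?_)
    · refine le_comparisonBound (ℓ := Nat.log 2 n + 1) (r := ceilCbrt n) h (ceilCbrt_le hn)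
        (by simpa using Nat.pow_log_le_self 2 (by omega)) ?_
      simpa [sampleSize] using this
    · rw [Finset.card_univ, Fintype.card_fin]
      -- As `n < 2 * 2 ^ log₂ n` and `t ≥ 2`, halving `log₂ n` times brings the size down to `t`.
      have h1 := Nat.lt_pow_succ_log_self (b := 2) (by norm_num) n
      rw [Nat.succ_eq_add_one, pow_succ] at h1
      have h2 : 2 * 2 ^ Nat.log 2 n ≤ sampleSize c n * 2 ^ Nat.log 2 n :=
        Nat.mul_le_mul_right _ (by omega)
      linarith

theorem findMax_fail {c n : ℕ} (hn : 1 ≤ n) {δ : ℝ} (hδ : 0 ≤ δ) (val : Fin n → ℝ) :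
    (findMax c n hn).FailLe δ val {i | IsKMax 3 δ val i} ((n : ℝ≥0∞) ^ c)⁻¹ := by
  have : Nonempty (Fin n) := ⟨⟨0, hn⟩⟩
  obtain ⟨x, hx⟩ := Finite.exists_max val
  unfold findMax
  split_ifs with h
  · exact (RandAlg.failLe_roundRobin hδ _ hx (Finset.mem_univ x) (by linarith)).mono (by simp)
  rw [not_lt] at h
  have : NeZero (15 * (c + 2)) := ⟨by omega⟩
  have hr : 0 < ceilCbrt n := by
    refine Nat.pos_of_ne_zero fun h0 => ?_
    have := le_ceilCbrt_pow n
    simp [h0] at this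
    omega
  have hs : 15 * (c + 2) = 5 * (3 * (c + 2)) := by ring
  refine (RandAlg.failLe_eliminate hδ hx (D := 14 * ceilCbrt n) (N := n ^ (c + 1))
    (pow_ne_zero _ (by omega)) ?_ ?_ _ _ _ _ (Or.inl (Finset.mem_univ x))).mono ?_
  · intro b m _ hbm hd
    exact pow_missing_le (Nat.lt_pow_succ_log_self (by norm_num) n).le (by omega) hbm hd
  · intro b m _ hd
    rw [hs]
    exact choose_mul_le_pow hr (le_ceilCbrt_pow n) hd
  -- The extra factor `1 / n` in the failure probability of a round pays for the `log₂ n ≤ n`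
  -- rounds.
  · have hn0 : (n : ℝ≥0∞) ≠ 0 := by simp; omega
    have hle : (Nat.log 2 n : ℝ≥0∞) ≤ n := by exact_mod_cast Nat.log_le_self 2 n
    calc (Nat.log 2 n : ℝ≥0∞) * ((n ^ (c + 1) : ℕ) : ℝ≥0∞)⁻¹
        ≤ n * ((n : ℝ≥0∞)⁻¹ ^ c * (n : ℝ≥0∞)⁻¹) := by
          rw [Nat.cast_pow, ENNReal.inv_pow, pow_succ]; gcongr
      _ = (n * (n : ℝ≥0∞)⁻¹) * (n : ℝ≥0∞)⁻¹ ^ c := by ring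
      _ = ((n : ℝ≥0∞) ^ c)⁻¹ := by
          rw [ENNReal.mul_inv_cancel hn0 (by simp), one_mul, ENNReal.inv_pow]

end ImpreciseMax

theorem mainTheorem5 (c : ℕ) (hc : 1 ≤ c) :
    (fun n : ℕ => ImpreciseMax.comparisonBound c n) =O[Filter.atTop] (fun n : ℕ => (n : ℝ)) ∧
    ∃ A : (n : ℕ) → 1 ≤ n → ImpreciseMax.RandAlg n,
      ∀ (n : ℕ) (hn : 1 ≤ n) (δ : ℝ) (val : Fin n → ℝ) (cmp : ImpreciseMax.Comparator n),
        0 < δ → cmp.IsValid δ val →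
          (∀ p ∈ ((A n hn).run cmp []).support, (p.2 : ℝ) ≤ ImpreciseMax.comparisonBound c n) ∧
          1 - (n : ℝ) ^ (-(c : ℤ)) ≤
            (((A n hn).run cmp []).toOuterMeasure
              {p | ImpreciseMax.IsKMax 3 δ val p.1}).toReal := by
  refine ⟨ImpreciseMax.isBigO_comparisonBound c, ImpreciseMax.findMax c,
    fun n hn δ val cmp hδ hv => ⟨fun p hp => ?_, ?_⟩⟩
  · exact ImpreciseMax.findMax_cost hc hn fun N hN => hN cmp [] p hp
  · have hfail := ImpreciseMax.findMax_fail (c := c) hn hδ.le val cmp hv []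
    set P := (ImpreciseMax.findMax c n hn).run cmp []
    let _ : MeasurableSpace (Fin n × ℕ) := ⊤
    rw [← PMF.toMeasure_apply_eq_toOuterMeasure] at hfail ⊢
    change 1 - _ ≤ P.toMeasure.real _
    have hcompl := MeasureTheory.probReal_compl_eq_one_sub (μ := P.toMeasure)
      (s := {p | ImpreciseMax.IsKMax 3 δ val p.1}) trivial
    have hle : P.toMeasure.real {p | ImpreciseMax.IsKMax 3 δ val p.1}ᶜ ≤ (n : ℝ) ^ (-(c : ℤ)) := by
      have := ENNReal.toReal_mono (by simp; omega) hfail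
      simpa [MeasureTheory.measureReal_def, Set.compl_def] using this
    linarith
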